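/- For $n,d\ge 0$ and $s\ge 1$, let the class $s$-Sparse Polynomial of Degree $d$ consist of all Boolean functions $f:\{0,1\}^n\to\{0,1\}$ that are sums over $\mathbb F_2$ of at most $s$ monotone terms $\prod_{i\in S}x_i$, $S\subseteq[n]$, $|S|\le d$ (the empty term is the constant $1$, the empty sum is the constant $0$). A (two-sided, adaptive, randomized) algorithm may ask membership queries (it chooses $x\in\{0,1\}^n$ and receives $f(x)$) and example queries (it receives $x\in\{0,1\}^n$ drawn from a distribution $\mathcal D$), and may use its own random choices. For $\varepsilon>0$, it is an $\varepsilon$-tester for a class $C$ under $\mathcal D$ if it accepts every $f\in C$ with probability at least $2/3$, and rejects with probability at least $2/3$ every $f:\{0,1\}^n\to\{0,1\}$ that satisfies $\Pr_{x\sim\mathcal D}[f(x)\ne g(x)]\ge\varepsilon$ for all $g\in C$. In the uniform model $\mathcal D$ is the uniform distribution; a distribution-free tester is an $\varepsilon$-tester under every, unknown, distribution $\mathcal D$ on $\{0,1\}^n$. The query complexity is the maximum number of queries (membership and example queries together) made on any Boolean function. $\tilde O(T)$ stands for $O(T\cdot\mathrm{poly}(\log T))$, meaning here that for some absolute constants $K,c$,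 independent of $n,s,d,\varepsilon$, the quantity is at most $K\,T\,(1+\log T)^{c}$ for all values of the parameters. Theorem. For all $n,d\ge 0$, $s\ge 1$ and $\varepsilon>0$: (1) there is an adaptive $\varepsilon$-tester in the uniform model for $s$-Sparse Polynomial of Degree $d$ that makes $\tilde O(s/\varepsilon+s2^d)$ queries; (2) there is a distribution-free adaptive $\varepsilon$-tester for $s$-Sparse Polynomial of Degree $d$ that makes $\tilde O(s^2/\varepsilon+s2^d)$ queries. -/

import Mathlib

namespace SparsePolyTest

/-- The Boolean cube `{0,1}^n`, with bits regarded as elements of the field `F_2`. -/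
abbrev Cube (n : ℕ) : Type := Fin n → ZMod 2

/-- Boolean functions on `{0,1}^n`. -/
abbrev BoolFun (n : ℕ) : Type := Cube n → ZMod 2

/-- The class of `s`-sparse polynomials of degree `d` over `F_2` in `n` variables: Boolean
functions that are sums over `F_2` of at most `s` monotone terms `∏ i ∈ S, x_i`, each with at
most `d` variables (the empty term is the constant `1`, the empty sum is the constant `0`). -/
def sparsePoly (n s d : ℕ) : Set (BoolFun n) :=
  {f | ∃ F : Finset (Finset (Fin n)),
    F.card ≤ s ∧ (∀ S ∈ F, S.card ≤ d) ∧ ∀ x, f x = ∑ S ∈ F, ∏ i ∈ S, x i}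

/-- `Pr_{x ∈ D}[f x ≠ g x]`. -/
noncomputable def disagree {n : ℕ} (D : PMF (Cube n)) (f g : BoolFun n) : ℝ :=
  (∑ x with f x ≠ g x, D x).toReal

/-- `f` is `ε`-far, with respect to `D`, from every function in the class `C`. -/
def IsFarFrom {n : ℕ} (D : PMF (Cube n)) (ε : ℝ) (f : BoolFun n) (C : Set (BoolFun n)) : Prop :=
  ∀ g ∈ C, ε ≤ disagree D f g

/-- Randomized adaptive query algorithms for Boolean functions on `{0,1}^n`: at every step the
algorithm either halts with a verdict, or asks a membership query at a string of its choice, or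
asks an example query, or tosses a fair die of its own; how it goes on may depend on everything
that it has seen so far. -/
inductive QueryAlg (n : ℕ) : Type
  /-- Halt; `true` is "accept" and `false` is "reject". -/
  | output (verdict : Bool) : QueryAlg n
  /-- Membership query: ask for the value of the unknown function at `x`. -/
  | mq (x : Cube n) (next : ZMod 2 → QueryAlg n) : QueryAlg n
  /-- Example query: ask for a string drawn from the unknown distribution. -/
  | exq (next : Cube n → QueryAlg n) : QueryAlg n
  /-- Internal randomness (not a query): a uniformly random element of `{0,…,m}`. -/
  | rand (m : ℕ) (next : Fin (m + 1) → QueryAlg n) : QueryAlg n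

namespace QueryAlg

variable {n : ℕ}

/-- The distribution of the verdict when membership queries are answered by `f` and example
queries by independent draws from `D`. -/
noncomputable def run (f : BoolFun n) (D : PMF (Cube n)) : QueryAlg n → PMF Bool
  | output b => PMF.pure b
  | mq x next => run f D (next (f x))
  | exq next => D.bind fun x => run f D (next x)
  | rand m next => (PMF.uniformOfFintype (Fin (m + 1))).bind fun i => run f D (next i)

/-- The maximum, over all outcomes of the example queries and of the internal randomness, of the
number of queries (membership and example queries together) made on the function `f`. -/
def queries (f : BoolFun n) : QueryAlg n → ℕ
  | output _ => 0
  | mq x next => queries f (next (f x)) + 1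
  | exq next => (Finset.univ.sup fun x => queries f (next x)) + 1
  | rand _ next => Finset.univ.sup fun i => queries f (next i)

/-- `A` is a (two-sided) `ε`-tester for the class `C` when the underlying distribution is `D`. -/
def IsTesterUnder (A : QueryAlg n) (C : Set (BoolFun n)) (ε : ℝ) (D : PMF (Cube n)) : Prop :=
  (∀ f ∈ C, 2 / 3 ≤ (A.run f D true).toReal) ∧
    (∀ f, IsFarFrom D ε f C → 2 / 3 ≤ (A.run f D false).toReal)

/-- `A` is a (two-sided) `ε`-tester for `C` in the uniform model. -/
def IsUniformTester (A : QueryAlg n) (C : Set (BoolFun n)) (ε : ℝ) : Prop :=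
  A.IsTesterUnder C ε (PMF.uniformOfFintype (Cube n))

/-- `A` is a (two-sided) distribution-free `ε`-tester for `C`. -/
def IsDistFreeTester (A : QueryAlg n) (C : Set (BoolFun n)) (ε : ℝ) : Prop :=
  ∀ D : PMF (Cube n), A.IsTesterUnder C ε D

end QueryAlg

end SparsePolyTest

namespace SparsePolyTest

open scoped BigOperators

/-! ### Probabilities over uniform seeds -/

/-! A single distribution-free tester with `Õ(s/ε + s 2^d)` queries proves both claims, since `s/ε ≤
s²/ε`.

Learning: throw the `n` variables into `6(sd)² + 1` random blocks. A member `f` of the class has at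
most `sd` relevant variables, so by a birthday bound the blocks separate them with probability at
least `5/6`. Collapsing each block to one variable turns `f` into a sparse polynomial in a number of
variables that does not depend on `n`. There are at most `2^L` such polynomials, with `L` about `sd
log(sd)`, and two distinct ones differ on a `2^{-d}` fraction of the cube
(`HasDegreeLE.prob_ne_zero_ge`). Hence `2^d (L + 3)` random values usually determine the collapsed
polynomial (`prob_not_determined_le`); `P` is any candidate consistent with them.

Verification: fix the other blocks at an assignment where `P` is sensitive to block `j`. For a
separated member of the class with the correct `P`, the restriction of `f` to block `j` is then a
single variable up to a constant, and every check passes (`roundCheck_of_injOn`). In general, either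
some relevant block function self-corrects to no coordinate and fails the dictator check with
constant probability (`prob_not_dictatorCheck_ge`), or the blocks name coordinates `i j`. In the
second case `x ↦ P (x ∘ i)` belongs to the class, so a far `f` differs from it at an example `x`
with probability at least `ε`, and self-correction computes `x ∘ i` on the relevant blocks without
knowing `i`. This needs no relation between `P` and `f`, so soundness holds however badly learning
went (`accept_roundAlg_le`). A round costs `O(sd log(sd))` queries and `O(1/ε)` rounds suffice; the
factor `d` is logarithmic in `s 2^d`. -/

open Classical in
/-- The probability of `p` at a uniformly random element of a finite type. -/
noncomputable def prob {α : Type*} [Fintype α] (p : α → Prop) : ℝ :=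
  𝔼 a, if p a then (1 : ℝ) else 0

section prob

variable {α β : Type*} [Fintype α] [Fintype β]

theorem prob_mono {p q : α → Prop} (h : ∀ a, p a → q a) : prob p ≤ prob q := by
  classical
  refine Finset.expect_le_expect fun a _ => ?_
  by_cases hp : p a
  · simp [hp, h a hp]
  · simp only [hp, if_false]; split_ifs <;> norm_num

theorem prob_nonneg (p : α → Prop) : 0 ≤ prob p :=
  Finset.expect_nonneg fun a _ => by split_ifs <;> norm_num

theorem prob_le_one (p : α → Prop) : prob p ≤ 1 := by
  classical
  rcases isEmpty_or_nonempty α with h | h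
  · simp [prob]
  · calc prob p ≤ 𝔼 _a : α, (1 : ℝ) := Finset.expect_le_expect fun a _ => by split_ifs <;> norm_num
      _ = 1 := Fintype.expect_const _

theorem prob_or_le (p q : α → Prop) : prob (fun a => p a ∨ q a) ≤ prob p + prob q := by
  classical
  rw [prob, prob, prob, ← Finset.expect_add_distrib]
  refine Finset.expect_le_expect fun a _ => ?_
  by_cases hp : p a <;> by_cases hq : q a <;> simp [hp, hq]

theorem prob_or_le_add {p q : α → Prop} {a b : ℝ} (hp : prob p ≤ a) (hq : prob q ≤ b) :
    prob (fun x => p x ∨ q x) ≤ a + b :=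
  (prob_or_le p q).trans (add_le_add hp hq)

theorem prob_false : prob (fun _ : α => False) = 0 := by simp [prob]

theorem prob_of_forall [Nonempty α] {p : α → Prop} (h : ∀ a, p a) : prob p = 1 := by
  simp [prob, h]

theorem prob_exists_mem_le {ι : Type*} (s : Finset ι) (p : ι → α → Prop) :
    prob (fun a => ∃ i ∈ s, p i a) ≤ ∑ i ∈ s, prob (p i) := by
  classical
  induction s using Finset.induction_on with
  | empty => simp [prob_false]
  | insert i s hi ih =>
    rw [Finset.sum_insert hi]
    refine le_trans (prob_mono (q := fun a => p i a ∨ ∃ j ∈ s, p j a) ?_)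
      ((prob_or_le _ _).trans (by gcongr))
    simp

theorem prob_not [Nonempty α] (p : α → Prop) : prob (fun a => ¬ p a) = 1 - prob p := by
  classical
  rw [eq_sub_iff_add_eq, prob, prob, ← Finset.expect_add_distrib,
    ← Fintype.expect_const (ι := α) (1 : ℝ)]
  refine Finset.expect_congr rfl fun a _ => ?_
  by_cases hp : p a <;> simp [hp]

theorem prob_equiv (e : α ≃ β) (p : β → Prop) : prob (fun a => p (e a)) = prob p := by
  classical
  exact Fintype.expect_equiv e _ _ fun _ => rfl

theorem prob_prod (p : α × β → Prop) : prob p = 𝔼 a, prob fun b => p (a, b) := by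
  classical
  unfold prob
  rw [← Finset.univ_product_univ, Finset.expect_product]

theorem prob_prod_le [Nonempty α] {p : α × β → Prop} {c : ℝ}
    (h : ∀ a, prob (fun b => p (a, b)) ≤ c) : prob p ≤ c := by
  rw [prob_prod, ← Fintype.expect_const (ι := α) c]
  exact Finset.expect_le_expect fun a _ => h a

theorem exists_prob_le_of_prob_prod_le [Nonempty α] {p : α × β → Prop} {c : ℝ} (h : prob p ≤ c) :
    ∃ a, prob (fun b => p (a, b)) ≤ c := by
  rw [prob_prod] at h
  by_contra! hc
  have := Finset.expect_lt_expect (s := Finset.univ) (f := fun _ : α => c)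
    (g := fun a => prob fun b => p (a, b)) (fun a _ => (hc a).le)
    ⟨Classical.arbitrary α, Finset.mem_univ _, hc _⟩
  rw [Fintype.expect_const] at this
  linarith

theorem prob_comp_fst [Nonempty β] (p : α → Prop) : prob (fun a : α × β => p a.1) = prob p := by
  classical
  rw [prob_prod]
  unfold prob
  exact Finset.expect_congr rfl fun a _ => Fintype.expect_const (ι := β) (if p a then (1 : ℝ) else 0)

theorem prob_comp_snd [Nonempty α] (p : β → Prop) : prob (fun a : α × β => p a.2) = prob p := by
  rw [prob_prod]
  exact Fintype.expect_const (ι := α) (prob p)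

theorem exists_not_of_prob_lt_one [Nonempty α] {p : α → Prop} (h : prob p < 1) : ∃ a, ¬ p a := by
  by_contra! hc
  exact h.ne (prob_of_forall hc)

open Classical in
theorem prob_eq_card_div (p : α → Prop) :
    prob p = ((Finset.univ.filter p).card : ℝ) / Fintype.card α := by
  rw [prob, Fintype.expect_eq_sum_div_card, Finset.sum_boole]

theorem prob_forall_eq_pow (p : α → Prop) (t : ℕ) :
    prob (fun U : Fin t → α => ∀ k, p (U k)) = prob p ^ t := by
  classical
  have h : (Finset.univ.filter fun U : Fin t → α => ∀ k, p (U k))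
      = Fintype.piFinset fun _ => Finset.univ.filter p := by
    ext U; simp
  rw [prob_eq_card_div, prob_eq_card_div, div_pow]
  congr 1
  · rw [← Nat.cast_pow]
    congr 1
    convert congrArg Finset.card h
    simp [Fintype.card_piFinset]
  · simp

end prob

/-! ### Building blocks for query algorithms -/

namespace QueryAlg

variable {n : ℕ}

/-- The acceptance probability. -/
noncomputable def accept (f : BoolFun n) (D : PMF (Cube n)) (A : QueryAlg n) : ℝ :=
  (A.run f D true).toReal

theorem accept_nonneg (f : BoolFun n) (D : PMF (Cube n)) (A : QueryAlg n) : 0 ≤ A.accept f D :=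
  ENNReal.toReal_nonneg

theorem run_false_toReal (f : BoolFun n) (D : PMF (Cube n)) (A : QueryAlg n) :
    (A.run f D false).toReal = 1 - A.accept f D := by
  have h := (A.run f D).tsum_coe
  rw [tsum_fintype, Fintype.sum_bool] at h
  have h' := congrArg ENNReal.toReal h
  rw [ENNReal.toReal_add (PMF.apply_ne_top _ _) (PMF.apply_ne_top _ _)] at h'
  rw [accept]; simp at h'; linarith

theorem toReal_bind_apply {α : Type*} [Fintype α] (p : PMF α) (q : α → PMF Bool) (b : Bool) :
    ((p.bind q) b).toReal = ∑ a, (p a).toReal * (q a b).toReal := by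
  rw [PMF.bind_apply, tsum_fintype, ENNReal.toReal_sum]
  · simp
  · exact fun a _ => ENNReal.mul_ne_top (PMF.apply_ne_top _ _) (PMF.apply_ne_top _ _)

theorem accept_output (f : BoolFun n) (D : PMF (Cube n)) (b : Bool) :
    (output b : QueryAlg n).accept f D = if b then 1 else 0 := by
  cases b <;> simp [accept, run]

theorem accept_mq (f : BoolFun n) (D : PMF (Cube n)) (x : Cube n) (next : ZMod 2 → QueryAlg n) :
    (mq x next).accept f D = (next (f x)).accept f D := rfl

theorem accept_exq (f : BoolFun n) (D : PMF (Cube n)) (next : Cube n → QueryAlg n) :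
    (exq next).accept f D = ∑ x, (D x).toReal * (next x).accept f D := by
  simp only [accept, run, toReal_bind_apply]

theorem accept_rand (f : BoolFun n) (D : PMF (Cube n)) (m : ℕ) (next : Fin (m + 1) → QueryAlg n) :
    (rand m next).accept f D = 𝔼 i, (next i).accept f D := by
  simp only [accept, run, toReal_bind_apply, PMF.uniformOfFintype_apply]
  rw [Fintype.expect_eq_sum_div_card, Finset.sum_div]
  refine Finset.sum_congr rfl fun i _ => ?_
  rw [Fintype.card_fin, ENNReal.toReal_inv, ENNReal.toReal_natCast, div_eq_inv_mul]

/-- Draw a uniformly random element of a finite type. -/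
noncomputable def randOver (Ω : Type*) [Fintype Ω] [Nonempty Ω] (next : Ω → QueryAlg n) :
    QueryAlg n :=
  rand (Fintype.card Ω - 1) fun i =>
    next ((Fintype.equivFin Ω).symm (Fin.cast (Nat.sub_add_cancel Fintype.card_pos) i))

theorem accept_randOver (f : BoolFun n) (D : PMF (Cube n)) {Ω : Type*} [Fintype Ω] [Nonempty Ω]
    (next : Ω → QueryAlg n) :
    (randOver Ω next).accept f D = 𝔼 ω, (next ω).accept f D := by
  rw [randOver, accept_rand]
  exact Fintype.expect_equiv
    ((finCongr (Nat.sub_add_cancel Fintype.card_pos)).trans (Fintype.equivFin Ω).symm) _ _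
    fun _ => rfl

theorem queries_randOver_le (f : BoolFun n) {Ω : Type*} [Fintype Ω] [Nonempty Ω]
    (next : Ω → QueryAlg n) {c : ℕ} (h : ∀ ω, (next ω).queries f ≤ c) :
    (randOver Ω next).queries f ≤ c :=
  Finset.sup_le fun _ _ => h _

/-- Run `A`; if it accepts, run `B`, otherwise reject. -/
def andThen (B : QueryAlg n) : QueryAlg n → QueryAlg n
  | output b => if b then B else output false
  | mq x next => mq x fun v => andThen B (next v)
  | exq next => exq fun x => andThen B (next x)
  | rand m next => rand m fun i => andThen B (next i)

theorem accept_andThen (f : BoolFun n) (D : PMF (Cube n)) (A B : QueryAlg n) :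
    (andThen B A).accept f D = A.accept f D * B.accept f D := by
  induction A with
  | output b => cases b <;> simp [andThen, accept_output]
  | mq x next ih => simp [andThen, accept_mq, ih]
  | exq next ih => simp [andThen, accept_exq, ih, Finset.sum_mul, mul_assoc]
  | rand m next ih => simp [andThen, accept_rand, ih, Finset.expect_mul]

theorem queries_andThen_le (f : BoolFun n) (A B : QueryAlg n) :
    (andThen B A).queries f ≤ A.queries f + B.queries f := by
  induction A with
  | output b => cases b <;> simp [andThen, queries]
  | mq x next ih => simp only [andThen, queries]; have := ih (f x); omega
  | exq next ih =>
    simp only [andThen, queries]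
    have : (Finset.univ.sup fun x => (andThen B (next x)).queries f)
        ≤ (Finset.univ.sup fun x => (next x).queries f) + B.queries f :=
      Finset.sup_le fun x hx => (ih x).trans
        (Nat.add_le_add_right (Finset.le_sup (f := fun x => (next x).queries f) hx) _)
    omega
  | rand m next ih =>
    simp only [andThen, queries]
    exact Finset.sup_le fun x hx => (ih x).trans
        (Nat.add_le_add_right (Finset.le_sup (f := fun x => (next x).queries f) hx) _)

/-- Accept if `m` independent runs of `A` all accept. -/
def repeatAll (A : QueryAlg n) : ℕ → QueryAlg n
  | 0 => output true
  | m + 1 => andThen (repeatAll A m) A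

theorem accept_repeatAll (f : BoolFun n) (D : PMF (Cube n)) (A : QueryAlg n) (m : ℕ) :
    (repeatAll A m).accept f D = A.accept f D ^ m := by
  induction m with
  | zero => simp [repeatAll, accept_output]
  | succ m ih => rw [repeatAll, accept_andThen, ih, pow_succ']

theorem queries_repeatAll_le (f : BoolFun n) (A : QueryAlg n) (m : ℕ) :
    (repeatAll A m).queries f ≤ m * A.queries f := by
  induction m with
  | zero => simp [repeatAll, queries]
  | succ m ih =>
    rw [repeatAll, Nat.succ_mul, add_comm]
    exact (queries_andThen_le _ _ _).trans (by omega)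

/-- Query all strings in a list, recording the answers in a table. -/
def queryList (k : BoolFun n → QueryAlg n) : List (Cube n) → BoolFun n → QueryAlg n
  | [], g => k g
  | x :: l, g => mq x fun v => queryList k l (Function.update g x v)

/-- Points where the table is already right are carried along: after the head is queried it need not
occur in the tail, and later updates must not spoil it. -/
theorem queryList_spec (k : BoolFun n → QueryAlg n) (f : BoolFun n) (l : List (Cube n))
    (g : BoolFun n) :
    ∃ g' : BoolFun n, (∀ x, x ∈ l ∨ g x = f x → g' x = f x) ∧
      (∀ D, (queryList k l g).accept f D = (k g').accept f D) ∧
      (queryList k l g).queries f = (k g').queries f + l.length := by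
  induction l generalizing g with
  | nil => exact ⟨g, by simp, fun _ => rfl, rfl⟩
  | cons x l ih =>
    obtain ⟨g', h1, h2, h3⟩ := ih (Function.update g x (f x))
    refine ⟨g', fun y hy => h1 y ?_, h2, ?_⟩
    · by_cases hyx : y = x
      · subst hyx; simp
      · simpa [hyx] using hy
    · simp only [queryList, queries, h3, List.length_cons]; omega

/-- Query all strings in a finite set and continue with a table of the answers. -/
noncomputable def queryAll (S : Finset (Cube n)) (k : BoolFun n → QueryAlg n) : QueryAlg n :=
  queryList k S.toList 0

theorem queryAll_spec (S : Finset (Cube n)) (k : BoolFun n → QueryAlg n) (f : BoolFun n) :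
    ∃ g : BoolFun n, (∀ x ∈ S, g x = f x) ∧
      (∀ D, (queryAll S k).accept f D = (k g).accept f D) ∧
      (queryAll S k).queries f = (k g).queries f + S.card := by
  obtain ⟨g, h1, h2, h3⟩ := queryList_spec k f S.toList 0
  exact ⟨g, fun x hx => h1 x (Or.inl (by simpa using hx)), h2, by simpa [queryAll] using h3⟩

end QueryAlg

/-! ### Self-correction and the dictator test -/

section dictator

variable {n : ℕ}

theorem zmod_two_eq_zero_or_one (a : ZMod 2) : a = 0 ∨ a = 1 := by
  revert a; decide

/-- The self-corrected value of `g` at `p` with random shift `u`. -/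
def decode (g : BoolFun n) (p u : Cube n) : ZMod 2 := g (p + u) + g u

/-- The check of the dictator test on the random strings `y`, `z`, `u`. -/
def DictatorCheck (g : BoolFun n) (ω : (Cube n × Cube n) × Cube n) : Prop :=
  g ω.1.1 + g ω.1.2 = g (ω.1.1 + ω.1.2) ∧
    decode g (ω.1.1 * ω.1.2) ω.2 = decode g ω.1.1 ω.2 * decode g ω.1.2 ω.2 ∧
    decode g 1 ω.2 = 1

/-- Self-correction of `g` yields the `i`-th coordinate with good probability everywhere. -/
def DecodesTo (g : BoolFun n) (i : Fin n) : Prop :=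
  ∀ p, prob (fun u => decode g p u ≠ p i) ≤ 1 / 16

/-- Decodings of `p` with two independent shifts agree unless one of two linearity checks, each on a
uniform pair, fails. Averaging fixes one shift, whose decoding serves as `c`. -/
theorem exists_decode_eq {g : BoolFun n} {δ : ℝ}
    (h : prob (fun ω : Cube n × Cube n => g ω.1 + g ω.2 ≠ g (ω.1 + ω.2)) ≤ δ) (p : Cube n) :
    ∃ c, prob (fun u => decode g p u ≠ c) ≤ 2 * δ := by
  let E : Cube n × Cube n → Prop := fun ω => g ω.1 + g ω.2 ≠ g (ω.1 + ω.2)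
  have h1 : prob (fun ω : Cube n × Cube n => E (p + ω.1, ω.2)) ≤ δ :=
    (prob_equiv ((Equiv.addLeft p).prodCongr (Equiv.refl _)) E).trans_le h
  have h2 : prob (fun ω : Cube n × Cube n => E (p + ω.2, ω.1)) ≤ δ :=
    (prob_equiv ((Equiv.prodComm _ _).trans ((Equiv.addLeft p).prodCongr (Equiv.refl _))) E).trans_le
      h
  have h3 : prob (fun ω : Cube n × Cube n => decode g p ω.2 ≠ decode g p ω.1) ≤ 2 * δ := by
    refine (prob_mono ?_).trans ((prob_or_le _ _).trans (add_le_add h1 h2)) |>.trans (by linarith)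
    rintro ⟨y, z⟩ hne
    by_contra! hE
    simp only [E, not_not] at hE
    apply hne
    obtain ⟨ha, hb⟩ := hE
    rw [show p + z + y = p + y + z by abel] at hb
    have := ha.trans hb.symm
    simp only [decode]
    revert this
    generalize g (p + y) = a; generalize g z = b; generalize g (p + z) = c; generalize g y = e
    revert a b c e; decide
  obtain ⟨y, hy⟩ := exists_prob_le_of_prob_prod_le h3
  exact ⟨decode g p y, hy⟩

/-- A telescoping sum: additivity of decoding is exact once the first shift is moved to `y + u`,
which is still uniform. -/
theorem decode_add (g : BoolFun n) (x y u : Cube n) :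
    decode g (x + y) u = decode g x (y + u) + decode g y u := by
  simp only [decode, add_assoc]
  generalize g (x + (y + u)) = a; generalize g (y + u) = b; generalize g u = c
  revert a b c; decide

/-- A multiplicative unital additive function on the cube is a coordinate. -/
theorem exists_eq_coordinate {φ : Cube n → ZMod 2} (hadd : ∀ x y, φ (x + y) = φ x + φ y)
    (hmul : ∀ x y, φ (x * y) = φ x * φ y) (hone : φ 1 = 1) : ∃ i, ∀ x, φ x = x i := by
  let ψ : Cube n →+ ZMod 2 := AddMonoidHom.mk' φ hadd
  -- The unit vectors add up to `1`, so `φ` is nonzero on one of them; multiplication by that vector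
  -- isolates its coordinate.
  have hsum : ∑ i, φ (Pi.single i 1) = 1 := by
    have : ψ (∑ i, Pi.single i (1 : ZMod 2)) = ∑ i, ψ (Pi.single i 1) := map_sum ψ _ _
    have h1 : (∑ i, Pi.single i (1 : ZMod 2) : Cube n) = 1 :=
      Finset.univ_sum_single (1 : Cube n)
    rw [h1] at this
    exact this.symm.trans hone
  obtain ⟨i, -, hi⟩ := Finset.exists_ne_zero_of_sum_ne_zero (hsum.trans_ne one_ne_zero)
  have hi1 : φ (Pi.single i 1) = 1 := (zmod_two_eq_zero_or_one _).resolve_left hi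
  refine ⟨i, fun x => ?_⟩
  have hx : φ x = φ (Pi.single i (x i)) := by
    have : x * Pi.single i 1 = Pi.single i (x i) := by
      ext j
      by_cases hj : j = i
      · subst hj; simp
      · simp [hj]
    rw [← this, hmul, hi1, mul_one]
  rw [hx]
  rcases zmod_two_eq_zero_or_one (x i) with h | h
  · rw [h, Pi.single_zero]; exact map_zero ψ
  · rw [h, hi1]

/-- A function that self-corrects to no coordinate fails the dictator check with constant
probability. -/
theorem prob_not_dictatorCheck_ge {g : BoolFun n} (hg : ∀ i, ¬ DecodesTo g i) :
    1 / 32 ≤ prob fun ω => ¬ DictatorCheck g ω := by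
  by_contra! hlt
  have hlin : prob (fun ω : Cube n × Cube n => g ω.1 + g ω.2 ≠ g (ω.1 + ω.2)) ≤ 1 / 32 := by
    rw [← prob_comp_fst (β := Cube n)]
    exact (prob_mono fun ω h1 h2 => h1 h2.1).trans hlt.le
  -- `φ` is the majority decoding. Each law for `φ` is exact: the failure probabilities add up to
  -- less than `1`, so some random choice satisfies all the relations involved.
  choose φ hφ using exists_decode_eq hlin
  have hφ' : ∀ p, prob (fun u => decode g p u ≠ φ p) ≤ 1 / 16 := fun p => (hφ p).trans (by norm_num)
  have hadd : ∀ x y, φ (x + y) = φ x + φ y := by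
    intro x y
    have h1 : prob (fun u => decode g x (y + u) ≠ φ x) ≤ 1 / 16 :=
      (prob_equiv (Equiv.addLeft y) fun u => decode g x u ≠ φ x).trans_le (hφ' x)
    obtain ⟨u, hu⟩ := exists_not_of_prob_lt_one 
      (lt_of_le_of_lt (prob_or_le_add h1 (prob_or_le_add (hφ' y) (hφ' (x + y)))) (by norm_num))
    simp only [not_or, not_not] at hu
    rw [← hu.1, ← hu.2.1, ← hu.2.2, decode_add]
  have hone : φ 1 = 1 := by
    have h1 : prob (fun u => decode g 1 u ≠ 1) ≤ 1 / 32 := by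
      rw [← prob_comp_snd (α := Cube n × Cube n)]
      exact (prob_mono fun ω h1 h2 => h1 h2.2.2).trans hlt.le
    obtain ⟨u, hu⟩ := exists_not_of_prob_lt_one 
      (lt_of_le_of_lt (prob_or_le_add h1 (hφ' 1)) (by norm_num))
    simp only [not_or, not_not] at hu
    rw [← hu.2, hu.1]
  have hmul : ∀ x y, φ (x * y) = φ x * φ y := by
    by_contra! hne
    obtain ⟨x, y, hxy⟩ := hne
    -- The check fails with probability below `1/32` and three decodings with `1/16` each, in total
    -- `7/32`. Four translates of `B` still leave a good pair, where bilinear expansion isolates `φ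
    -- (x * y) = φ x * φ y`.
    let B : Cube n × Cube n → Prop := fun ω => φ (ω.1 * ω.2) ≠ φ ω.1 * φ ω.2
    have hB : prob B ≤ 7 / 32 := by
      rw [← prob_comp_fst (β := Cube n)]
      let Q : (Cube n × Cube n) × Cube n → Prop := fun ω =>
        decode g (ω.1.1 * ω.1.2) ω.2 ≠ φ (ω.1.1 * ω.1.2) ∨
          (decode g ω.1.1 ω.2 ≠ φ ω.1.1 ∨ decode g ω.1.2 ω.2 ≠ φ ω.1.2)
      have hd : prob Q ≤ 1 / 16 + (1 / 16 + 1 / 16) := by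
        refine prob_prod_le fun ω => ?_
        exact prob_or_le_add (hφ' (ω.1 * ω.2)) (prob_or_le_add (hφ' ω.1) (hφ' ω.2))
      have hQ := prob_or_le_add hlt.le hd
      refine le_trans (prob_mono ?_) (hQ.trans (by norm_num))
      intro ω hω
      by_contra hc
      simp only [Q, not_or, not_not] at hc
      apply hω
      rw [← hc.2.1, ← hc.2.2.1, ← hc.2.2.2, hc.1.2.1]
    have h1 : prob (fun ω : Cube n × Cube n => B (x + ω.1, ω.2)) ≤ 7 / 32 :=
      (prob_equiv ((Equiv.addLeft x).prodCongr (Equiv.refl _)) B).trans_le hB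
    have h2 : prob (fun ω : Cube n × Cube n => B (ω.1, y + ω.2)) ≤ 7 / 32 :=
      (prob_equiv ((Equiv.refl _).prodCongr (Equiv.addLeft y)) B).trans_le hB
    have h3 : prob (fun ω : Cube n × Cube n => B (x + ω.1, y + ω.2)) ≤ 7 / 32 :=
      (prob_equiv ((Equiv.addLeft x).prodCongr (Equiv.addLeft y)) B).trans_le hB
    obtain ⟨ω, hω⟩ := exists_not_of_prob_lt_one 
      (lt_of_le_of_lt (prob_or_le_add (prob_or_le_add hB h1) (prob_or_le_add h2 h3))
        (by norm_num))
    simp only [B, not_or, not_not, add_mul, mul_add, hadd] at hω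
    obtain ⟨⟨ha, hb⟩, hc, hd⟩ := hω
    apply hxy
    linear_combination hd - hb - hc + ha
  obtain ⟨i, hi⟩ := exists_eq_coordinate hadd hmul hone
  exact hg i fun p => by rw [← hi p]; exact hφ' p

end dictator

/-! ### Sparse polynomials -/

section sparse

variable {n r s d : ℕ}

/-- A sum of `#A` terms of degree at most `d`, repetitions allowed, is a sparse polynomial. -/
theorem sum_prod_mem_sparsePoly {ι : Type*} (A : Finset ι) (S : ι → Finset (Fin n))
    (hS : ∀ a ∈ A, (S a).card ≤ d) :
    (fun x => ∑ a ∈ A, ∏ i ∈ S a, x i) ∈ sparsePoly n A.card d := by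
  classical
  induction A using Finset.induction_on with
  | empty => exact ⟨∅, by simp, by simp, by simp⟩
  | insert a A ha ih =>
    obtain ⟨F, h1, h2, h3⟩ := ih fun b hb => hS b (Finset.mem_insert_of_mem hb)
    have ha' := hS a (Finset.mem_insert_self _ _)
    rw [Finset.card_insert_of_notMem ha]
    -- A repeated term cancels in characteristic two.
    by_cases hF : S a ∈ F
    · refine ⟨F.erase (S a), (Finset.card_le_card (Finset.erase_subset _ _)).trans (by omega),
        fun T hT => h2 T (Finset.mem_of_mem_erase hT), fun x => ?_⟩
      have h4 := Finset.add_sum_erase F (fun T => ∏ i ∈ T, x i) hF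
      have h5 := h3 x
      beta_reduce at h5 ⊢
      rw [Finset.sum_insert ha, h5, ← h4, ← add_assoc, CharTwo.add_self_eq_zero, zero_add]
    · refine ⟨insert (S a) F, (Finset.card_insert_le _ _).trans (by omega), ?_, fun x => ?_⟩
      · intro T hT
        rcases Finset.mem_insert.1 hT with rfl | hT
        exacts [ha', h2 T hT]
      · have h5 := h3 x
        beta_reduce at h5 ⊢
        rw [Finset.sum_insert ha, h5, Finset.sum_insert hF]

theorem sparsePoly_mono {s' : ℕ} (h : s ≤ s') : sparsePoly n s d ⊆ sparsePoly n s' d :=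
  fun _ ⟨F, h1, h2, h3⟩ => ⟨F, h1.trans h, h2, h3⟩

/-- Variables merged by `b` collapse because `a * a = a` in `ZMod 2`. -/
theorem prod_image_eq (T : Finset (Fin r)) (b : Fin r → Fin n) (x : Cube n) :
    ∏ i ∈ T.image b, x i = ∏ j ∈ T, x (b j) := by
  classical
  induction T using Finset.induction_on with
  | empty => simp
  | insert j T hj ih =>
    rw [Finset.image_insert, Finset.prod_insert hj, ← ih]
    by_cases h : b j ∈ T.image b
    · rw [Finset.insert_eq_of_mem h, ← Finset.mul_prod_erase _ _ h, ← mul_assoc]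
      congr 1
      generalize x (b j) = a
      revert a; decide
    · rw [Finset.prod_insert h]

/-- Sparse polynomials are closed under identification and renaming of variables. -/
theorem comp_mem_sparsePoly {f : BoolFun r} (hf : f ∈ sparsePoly r s d) (b : Fin r → Fin n) :
    (fun x : Cube n => f (x ∘ b)) ∈ sparsePoly n s d := by
  classical
  obtain ⟨F, h1, h2, h3⟩ := hf
  refine sparsePoly_mono h1 ?_
  convert sum_prod_mem_sparsePoly F (fun T => T.image b)
    fun T hT => Finset.card_image_le.trans (h2 T hT) using 2 with x
  rw [h3]
  simp [prod_image_eq]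

/-- `P` is sensitive to its `j`-th coordinate at some point. -/
def IsRelevant (P : BoolFun r) (j : Fin r) : Prop :=
  ∃ w : Cube r, P (Function.update w j 0) ≠ P (Function.update w j 1)

theorem update_eq_of_not_isRelevant {P : BoolFun r} {j : Fin r} (hj : ¬ IsRelevant P j)
    (v : Cube r) (c : ZMod 2) : P (Function.update v j c) = P v := by
  unfold IsRelevant at hj
  push Not at hj
  have h : ∀ a, P (Function.update v j a) = P (Function.update v j 0) := fun a => by
    rcases zmod_two_eq_zero_or_one a with h | h
    · rw [h]
    · rw [h, hj]
  rw [h, ← h (v j), Function.update_eq_self]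

/-- Irrelevant coordinates are switched from `v` to `v'` one at a time. -/
theorem eq_of_forall_isRelevant {P : BoolFun r} {v v' : Cube r}
    (h : ∀ j, IsRelevant P j → v j = v' j) : P v = P v' := by
  classical
  have key : ∀ A : Finset (Fin r), (∀ j ∈ A, ¬ IsRelevant P j) →
      P (fun j => if j ∈ A then v' j else v j) = P v := by
    intro A
    induction A using Finset.induction_on with
    | empty => simp
    | insert j A hj ih =>
      intro hA
      rw [← ih fun k hk => hA k (Finset.mem_insert_of_mem hk),
        ← update_eq_of_not_isRelevant (hA j (Finset.mem_insert_self _ _))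
          (fun j => if j ∈ A then v' j else v j) (v' j)]
      congr 1
      ext k
      by_cases hk : k = j
      · subst hk; simp
      · simp [hk]
  rw [← key (Finset.univ.filter fun j => ¬ IsRelevant P j) (by simp)]
  congr 1
  ext j
  by_cases hj : IsRelevant P j
  · simp [hj, h j hj]
  · simp [hj]

/-- A sparse polynomial has few relevant coordinates. -/
theorem exists_support {f : BoolFun n} (hf : f ∈ sparsePoly n s d) :
    ∃ R : Finset (Fin n), R.card ≤ s * d ∧ ∀ x y : Cube n, (∀ i ∈ R, x i = y i) → f x = f y := by
  classical
  obtain ⟨F, h1, h2, h3⟩ := hf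
  refine ⟨F.biUnion id, (Finset.card_biUnion_le_card_mul _ _ _ h2).trans
    (Nat.mul_le_mul_right _ h1), fun x y hxy => ?_⟩
  rw [h3, h3]
  exact Finset.sum_congr rfl fun S hS => Finset.prod_congr rfl fun i hi =>
    hxy i (Finset.mem_biUnion.2 ⟨S, hS, hi⟩)

theorem mem_of_isRelevant {f : BoolFun n} {R : Finset (Fin n)}
    (hR : ∀ x y : Cube n, (∀ i ∈ R, x i = y i) → f x = f y) {i : Fin n} (hi : IsRelevant f i) :
    i ∈ R := by
  by_contra hiR
  obtain ⟨w, hw⟩ := hi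
  refine hw (hR _ _ fun k hk => ?_)
  have : k ≠ i := fun h => hiR (h ▸ hk)
  simp [this]

open Classical in
/-- The set of relevant coordinates. -/
noncomputable def relevant (P : BoolFun r) : Finset (Fin r) := Finset.univ.filter (IsRelevant P)

theorem mem_relevant {P : BoolFun r} {j : Fin r} : j ∈ relevant P ↔ IsRelevant P j := by
  simp [relevant]

theorem card_relevant_le {f : BoolFun n} (hf : f ∈ sparsePoly n s d) :
    (relevant f).card ≤ s * d := by
  obtain ⟨R, hR, h⟩ := exists_support hf
  exact (Finset.card_le_card fun i hi => mem_of_isRelevant h (mem_relevant.1 hi)).trans hR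

theorem const_mem_sparsePoly (hs : 1 ≤ s) (c : ZMod 2) :
    (fun _ => c) ∈ sparsePoly n s d := by
  rcases zmod_two_eq_zero_or_one c with h | h
  · exact ⟨∅, by simp, by simp, by simp [h]⟩
  · exact ⟨{∅}, by simpa using hs, by simp, by simp [h]⟩

/-! ### Degree through derivatives, and the distance between low-degree polynomials -/

/-- `f` has degree at most `d`, expressed through iterated derivatives. -/
def HasDegreeLE : ℕ → BoolFun n → Prop
  | 0, f => ∀ i x, f (x + Pi.single i 1) + f x = 0
  | d + 1, f => ∀ i, HasDegreeLE d fun x => f (x + Pi.single i 1) + f x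

theorem HasDegreeLE.zero_fun : HasDegreeLE d (fun _ : Cube n => (0 : ZMod 2)) := by
  induction d with
  | zero => simp [HasDegreeLE]
  | succ d ih => intro i; simpa using ih

theorem HasDegreeLE.add {f g : BoolFun n} (hf : HasDegreeLE d f) (hg : HasDegreeLE d g) :
    HasDegreeLE d fun x => f x + g x := by
  induction d generalizing f g with
  | zero => intro i x; have h1 := hf i x; have h2 := hg i x; linear_combination h1 + h2
  | succ d ih =>
    intro i
    convert ih (hf i) (hg i) using 2
    ring

/-- Differentiating along a unit vector strips that variable, since `(a + 1) + a = 1`; this is what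
lowers the degree of a term. -/
theorem prod_add_single_add (S : Finset (Fin n)) (i : Fin n) (x : Cube n) :
    (∏ k ∈ S, (x + Pi.single i 1 : Cube n) k) + ∏ k ∈ S, x k =
      if i ∈ S then ∏ k ∈ S.erase i, x k else 0 := by
  classical
  have h : ∀ T : Finset (Fin n), i ∉ T → ∏ k ∈ T, (x + Pi.single i 1 : Cube n) k = ∏ k ∈ T, x k :=
    fun T hT => Finset.prod_congr rfl fun k hk => by
      have : k ≠ i := fun h => hT (h ▸ hk)
      simp [this]
  split_ifs with hi
  · rw [← Finset.mul_prod_erase S _ hi, ← Finset.mul_prod_erase S (fun k => x k) hi,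
      h _ (Finset.notMem_erase _ _), ← add_mul]
    convert one_mul _
    simp only [Pi.add_apply, Pi.single_eq_same]
    generalize x i = a
    revert a; decide
  · rw [h S hi, CharTwo.add_self_eq_zero]

theorem HasDegreeLE.prod {S : Finset (Fin n)} (hS : S.card ≤ d) :
    HasDegreeLE d fun x => ∏ i ∈ S, x i := by
  classical
  induction d generalizing S with
  | zero =>
    intro i x
    rw [Finset.card_eq_zero.1 (Nat.le_zero.1 hS)]
    simp [CharTwo.add_self_eq_zero]
  | succ d ih =>
    intro i
    have h : (fun x : Cube n => (∏ k ∈ S, (x + Pi.single i 1 : Cube n) k) + ∏ k ∈ S, x k) =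
        fun x => if i ∈ S then ∏ k ∈ S.erase i, x k else 0 :=
      funext fun x => prod_add_single_add S i x
    rw [h]
    by_cases hi : i ∈ S
    · simp only [hi, if_true]
      exact ih (by rw [Finset.card_erase_of_mem hi]; omega)
    · simpa only [hi, if_false] using HasDegreeLE.zero_fun

theorem HasDegreeLE.of_mem_sparsePoly {f : BoolFun n} (hf : f ∈ sparsePoly n s d) :
    HasDegreeLE d f := by
  classical
  obtain ⟨F, -, h2, h3⟩ := hf
  rw [funext h3]
  clear h3
  induction F using Finset.induction_on with
  | empty => simpa using HasDegreeLE.zero_fun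
  | insert S F hSF ih =>
    simp only [Finset.sum_insert hSF]
    exact HasDegreeLE.add (.prod (h2 S (Finset.mem_insert_self _ _)))
      (ih fun T hT => h2 T (Finset.mem_insert_of_mem hT))

theorem HasDegreeLE.const_of_zero {f : BoolFun n} (hf : HasDegreeLE 0 f) (x : Cube n) :
    f x = f 0 := by
  classical
  have key : ∀ A : Finset (Fin n), f (∑ i ∈ A, Pi.single i (x i)) = f 0 := by
    intro A
    induction A using Finset.induction_on with
    | empty => simp
    | insert i A hi ih =>
      rw [Finset.sum_insert hi, ← ih]
      rcases zmod_two_eq_zero_or_one (x i) with h | h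
      · rw [h, Pi.single_zero, zero_add]
      · rw [h, add_comm]
        exact CharTwo.add_eq_zero.1 (hf i _)
  rw [← key Finset.univ, Finset.univ_sum_single]

/-- A nonzero function of degree at most `d` is nonzero on a `2⁻ᵈ` fraction of the cube. -/
theorem HasDegreeLE.prob_ne_zero_ge {f : BoolFun n} (hf : HasDegreeLE d f) (h0 : f ≠ 0) :
    (1 / 2 : ℝ) ^ d ≤ prob fun x => f x ≠ 0 := by
  have hconst : ∀ g : BoolFun n, HasDegreeLE 0 g → g ≠ 0 → prob (fun x => g x ≠ 0) = 1 := by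
    intro g hg hg0
    refine prob_of_forall fun x hx => hg0 (funext fun y => ?_)
    rw [hg.const_of_zero, ← hg.const_of_zero x, hx]; rfl
  induction d generalizing f with
  | zero => rw [hconst f hf h0]; simp
  | succ d ih =>
    by_cases hall : ∀ i, (fun x => f (x + Pi.single i 1) + f x) = 0
    · rw [hconst f (fun i x => congrFun (hall i) x) h0]
      exact pow_le_one₀ (by norm_num) (by norm_num)
    · push Not at hall
      obtain ⟨i, hi⟩ := hall
      -- Where the derivative is nonzero, `f` is nonzero at `x` or at its translate. Both events are
      -- equally likely, so each step in degree loses a factor of two.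
      have h1 := ih (hf i) hi
      have h2 : prob (fun x : Cube n => f (x + Pi.single i 1) ≠ 0) = prob fun x => f x ≠ 0 :=
        prob_equiv (Equiv.addRight (Pi.single i (1 : ZMod 2) : Cube n)) fun x => f x ≠ 0
      have h3 := prob_or_le_add h2.le (le_refl (prob fun x => f x ≠ 0))
      have h4 : prob (fun x : Cube n => f (x + Pi.single i 1) + f x ≠ 0) ≤
          prob fun x : Cube n => f (x + Pi.single i 1) ≠ 0 ∨ f x ≠ 0 := by
        refine prob_mono fun x hx => ?_
        by_contra hc
        rw [not_or, not_not, not_not] at hc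
        exact hx (by rw [hc.1, hc.2, add_zero])
      rw [pow_succ]
      linarith

end sparse

/-! ### The verification round -/

section round

variable {n r s d t : ℕ}

/-- The string that equals `z` on the `j`-th block of the partition `b` and is constant, with the
values given by `w`, on the other blocks. -/
def blockPoint (b : Fin n → Fin r) (w : Cube r) (j : Fin r) (z : Cube n) : Cube n :=
  fun i => if b i = j then z i else w (b i)

open Classical in
/-- An assignment at which `P` is sensitive to its `j`-th coordinate, if there is one. -/
noncomputable def witness (P : BoolFun r) (j : Fin r) : Cube r :=
  if h : IsRelevant P j then h.choose else 0

theorem witness_spec {P : BoolFun r} {j : Fin r} (h : IsRelevant P j) :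
    P (Function.update (witness P j) j 0) ≠ P (Function.update (witness P j) j 1) := by
  rw [witness, dif_pos h]; exact h.choose_spec

/-- The restriction of `f` to the `j`-th block at the sensitive assignment, normalized by `P`. -/
noncomputable def blockFun (f : BoolFun n) (P : BoolFun r) (b : Fin n → Fin r) (j : Fin r) :
    BoolFun n :=
  fun z => f (blockPoint b (witness P j) j z) + P (Function.update (witness P j) j 0)

/-- The random choices made in a verification round. -/
abbrev RoundSeed (n t : ℕ) : Type := ((Cube n × Cube n) × Cube n) × (Fin t → Cube n)

/-- The condition under which a verification round with the example `x` accepts: all relevant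
blocks pass the dictator check, the self-corrected values of the relevant variables at `x` are
consistent, and `P` takes the value `f x` at them. -/
def RoundCheck (f : BoolFun n) (P : BoolFun r) (b : Fin n → Fin r) (x : Cube n)
    (ω : RoundSeed n t) : Prop :=
  (∀ j ∈ relevant P, DictatorCheck (blockFun f P b j) ω.1) ∧
    ∃ v : Cube r, (∀ j ∈ relevant P, ∀ k, decode (blockFun f P b j) x (ω.2 k) = v j) ∧ f x = P v

/-- The strings at which the dictator check evaluates its function. -/
def dictatorPoints (ω : (Cube n × Cube n) × Cube n) : Fin 8 → Cube n :=
  ![ω.1.1, ω.1.2, ω.1.1 + ω.1.2, ω.1.1 * ω.1.2 + ω.2, ω.2, ω.1.1 + ω.2, ω.1.2 + ω.2, 1 + ω.2]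

/-- The strings at which the block functions are evaluated in a verification round. -/
def basePoints (x : Cube n) (ω : RoundSeed n t) : Finset (Cube n) :=
  Finset.univ.image (dictatorPoints ω.1) ∪
    (Finset.univ.image (fun k => x + ω.2 k) ∪ Finset.univ.image ω.2)

theorem card_basePoints_le (x : Cube n) (ω : RoundSeed n t) :
    (basePoints x ω).card ≤ 8 + 2 * t := by
  have h0 : (Finset.univ.image (dictatorPoints ω.1)).card ≤ 8 :=
    Finset.card_image_le.trans (by simp)
  have h1 : (Finset.univ.image (fun k => x + ω.2 k)).card ≤ t :=
    Finset.card_image_le.trans (by simp)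
  have h2 : (Finset.univ.image ω.2).card ≤ t := Finset.card_image_le.trans (by simp)
  refine (Finset.card_union_le _ _).trans (add_le_add h0 ?_)
  exact (Finset.card_union_le _ _).trans (by omega)

/-- The membership queries of a verification round. -/
noncomputable def roundPoints (P : BoolFun r) (b : Fin n → Fin r) (x : Cube n)
    (ω : RoundSeed n t) : Finset (Cube n) :=
  insert x ((relevant P ×ˢ basePoints x ω).image fun q => blockPoint b (witness P q.1) q.1 q.2)

theorem card_roundPoints_le {P : BoolFun r} (hP : P ∈ sparsePoly r s d) (b : Fin n → Fin r)
    (x : Cube n) (ω : RoundSeed n t) :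
    (roundPoints P b x ω).card ≤ s * d * (8 + 2 * t) + 1 := by
  refine (Finset.card_insert_le _ _).trans (Nat.add_le_add_right
    (Finset.card_image_le.trans ?_) 1)
  rw [Finset.card_product]
  exact Nat.mul_le_mul (card_relevant_le hP) (card_basePoints_le x ω)

/-- The verdict reads the function only at `roundPoints`, so the table of answers can stand in for
`f`. -/
theorem roundCheck_congr {f g : BoolFun n} {P : BoolFun r} {b : Fin n → Fin r} {x : Cube n}
    {ω : RoundSeed n t} (h : ∀ p ∈ roundPoints P b x ω, g p = f p) :
    RoundCheck g P b x ω ↔ RoundCheck f P b x ω := by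
  have hx : g x = f x := h x (Finset.mem_insert_self _ _)
  have hb : ∀ j ∈ relevant P, ∀ z ∈ basePoints x ω, blockFun g P b j z = blockFun f P b j z :=
    fun j hj z hz => by
      rw [blockFun, blockFun, h]
      exact Finset.mem_insert_of_mem
        (Finset.mem_image.2 ⟨(j, z), Finset.mem_product.2 ⟨hj, hz⟩, rfl⟩)
  have hc : ∀ j ∈ relevant P,
      (DictatorCheck (blockFun g P b j) ω.1 ↔ DictatorCheck (blockFun f P b j) ω.1) := by
    intro j hj
    have hk : ∀ k, blockFun g P b j (dictatorPoints ω.1 k) = blockFun f P b j (dictatorPoints ω.1 k) :=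
      fun k => hb j hj _ (Finset.mem_union_left _ (Finset.mem_image_of_mem _ (Finset.mem_univ k)))
    obtain ⟨⟨⟨y, z⟩, u⟩, U⟩ := ω
    have h0 : blockFun g P b j y = blockFun f P b j y := hk 0
    have h1 : blockFun g P b j z = blockFun f P b j z := hk 1
    have h2 : blockFun g P b j (y + z) = blockFun f P b j (y + z) := hk 2
    have h3 : blockFun g P b j (y * z + u) = blockFun f P b j (y * z + u) := hk 3
    have h4 : blockFun g P b j u = blockFun f P b j u := hk 4
    have h5 : blockFun g P b j (y + u) = blockFun f P b j (y + u) := hk 5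
    have h6 : blockFun g P b j (z + u) = blockFun f P b j (z + u) := hk 6
    have h7 : blockFun g P b j (1 + u) = blockFun f P b j (1 + u) := hk 7
    unfold DictatorCheck decode
    rw [h0, h1, h2, h3, h4, h5, h6, h7]
  have hd : ∀ j ∈ relevant P, ∀ k,
      decode (blockFun g P b j) x (ω.2 k) = decode (blockFun f P b j) x (ω.2 k) := by
    intro j hj k
    unfold decode
    rw [hb j hj (x + ω.2 k) (Finset.mem_union_right _ (Finset.mem_union_left _
        (Finset.mem_image_of_mem (fun k => x + ω.2 k) (Finset.mem_univ k)))),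
      hb j hj (ω.2 k) (Finset.mem_union_right _ (Finset.mem_union_right _
        (Finset.mem_image_of_mem _ (Finset.mem_univ k))))]
  unfold RoundCheck
  rw [hx]
  refine and_congr (forall₂_congr hc) (exists_congr fun v => and_congr_left' ?_)
  exact forall₂_congr fun j hj => forall_congr' fun k => by rw [hd j hj k]

open Classical in
/-- A verification round: test whether `f` is `P` applied to one variable from each block. -/
noncomputable def roundAlg (P : BoolFun r) (b : Fin n → Fin r) (t : ℕ) : QueryAlg n :=
  .exq fun x => .randOver (RoundSeed n t) fun ω => .queryAll (roundPoints P b x ω) fun a =>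
    .output (decide (RoundCheck a P b x ω))

theorem accept_roundAlg (f : BoolFun n) (D : PMF (Cube n)) (P : BoolFun r) (b : Fin n → Fin r) :
    (roundAlg P b t).accept f D =
      ∑ x, (D x).toReal * prob fun ω : RoundSeed n t => RoundCheck f P b x ω := by
  classical
  rw [roundAlg, QueryAlg.accept_exq]
  refine Finset.sum_congr rfl fun x _ => ?_
  rw [QueryAlg.accept_randOver, prob]
  congr 1
  refine Finset.expect_congr rfl fun ω _ => ?_
  obtain ⟨g, hg, h1, -⟩ := QueryAlg.queryAll_spec (roundPoints P b x ω)
    (fun a => .output (decide (RoundCheck a P b x ω))) f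
  rw [h1, QueryAlg.accept_output]
  simp [roundCheck_congr hg]

theorem queries_roundAlg_le (f : BoolFun n) {P : BoolFun r} (hP : P ∈ sparsePoly r s d)
    (b : Fin n → Fin r) :
    (roundAlg P b t).queries f ≤ s * d * (8 + 2 * t) + 2 := by
  classical
  -- The summand `2` pays for the example and for the membership query at it.
  refine Nat.succ_le_succ (Finset.sup_le fun x _ => ?_)
  refine QueryAlg.queries_randOver_le _ _ fun ω => ?_
  obtain ⟨g, -, -, h2⟩ := QueryAlg.queryAll_spec (roundPoints P b x ω)
    (fun a => .output (decide (RoundCheck a P b x ω))) f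
  rw [h2]
  simpa [QueryAlg.queries] using card_roundPoints_le hP b x ω

theorem sum_toReal_eq_one (D : PMF (Cube n)) : ∑ x, (D x).toReal = 1 := by
  have h := D.tsum_coe
  rw [tsum_fintype] at h
  rw [← ENNReal.toReal_sum fun x _ => PMF.apply_ne_top _ _, h, ENNReal.toReal_one]

theorem disagree_eq_sum (D : PMF (Cube n)) (f g : BoolFun n) :
    disagree D f g = ∑ x, (D x).toReal * if f x ≠ g x then 1 else 0 := by
  rw [disagree, ENNReal.toReal_sum fun x _ => PMF.apply_ne_top _ _, Finset.sum_filter]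
  simp

theorem disagree_le_one (D : PMF (Cube n)) (f g : BoolFun n) : disagree D f g ≤ 1 := by
  rw [disagree_eq_sum]
  refine (Finset.sum_le_sum fun x _ => ?_).trans_eq (sum_toReal_eq_one D)
  refine mul_le_of_le_one_right ENNReal.toReal_nonneg ?_
  split_ifs <;> norm_num

/-- A verification round rejects a function that is far from all sparse polynomials with
probability proportional to the distance. -/
theorem accept_roundAlg_le {f : BoolFun n} {D : PMF (Cube n)} {ε : ℝ} (hs : 1 ≤ s) (hε : 0 < ε)
    (hf : IsFarFrom D ε f (sparsePoly n s d)) {P : BoolFun r} (hP : P ∈ sparsePoly r s d)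
    (b : Fin n → Fin r) (ht : 2 * (s * d) ≤ 16 ^ t) :
    (roundAlg P b t).accept f D ≤ 1 - ε / 32 := by
  have hε1 : ε ≤ 1 := (hf _ (const_mem_sparsePoly hs 0)).trans (disagree_le_one _ _ _)
  -- In dimension zero every function is constant, hence not far. Nonemptiness supplies default
  -- coordinates for the irrelevant blocks below.
  have hn : Nonempty (Fin n) := by
    by_contra hn
    rw [not_nonempty_iff] at hn
    have h := hf _ (const_mem_sparsePoly hs (f 0))
    rw [disagree_eq_sum] at h
    have h0 : ∀ x : Cube n, x = 0 := fun x => Subsingleton.elim _ _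
    simp [h0] at h
    linarith
  rw [accept_roundAlg]
  by_cases hbad : ∃ j ∈ relevant P, ∀ i, ¬ DecodesTo (blockFun f P b j) i
  · obtain ⟨j, hj, hi⟩ := hbad
    have h1 := prob_not_dictatorCheck_ge hi
    rw [prob_not] at h1
    have h2 : ∀ x, prob (fun ω : RoundSeed n t => RoundCheck f P b x ω) ≤ 1 - ε / 32 := by
      intro x
      have : prob (fun ω : RoundSeed n t => RoundCheck f P b x ω) ≤
          prob fun ω : RoundSeed n t => DictatorCheck (blockFun f P b j) ω.1 :=
        prob_mono fun ω hω => hω.1 j hj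
      rw [prob_comp_fst] at this
      linarith
    calc _ ≤ ∑ x, (D x).toReal * (1 - ε / 32) :=
          Finset.sum_le_sum fun x _ => mul_le_mul_of_nonneg_left (h2 x) ENNReal.toReal_nonneg
      _ = 1 - ε / 32 := by rw [← Finset.sum_mul, sum_toReal_eq_one, one_mul]
  · push Not at hbad
    choose! i hi using hbad
    -- The map `i` need not be injective, and its values at irrelevant blocks do not matter to `P`.
    let h : BoolFun n := fun x => P (x ∘ i)
    have hfh : ε ≤ disagree D f h := hf h (comp_mem_sparsePoly hP i)
    have hx : ∀ x, prob (fun ω : RoundSeed n t => RoundCheck f P b x ω) ≤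
        1 - (if f x ≠ h x then 1 else 0) / 2 := by
      intro x
      by_cases hfx : f x = h x
      · simpa [hfx] using prob_le_one _
      -- One correct decoding of block `j` already forces `v j = x (i j)`, by consistency. A wrong
      -- `v j` thus needs all `t` shifts to err, and `16 ^ t ≥ 2sd` makes the union bound over
      -- blocks at most `1/2`.
      · let Q : Fin r → RoundSeed n t → Prop := fun j ω =>
          ∀ k, decode (blockFun f P b j) x (ω.2 k) ≠ x (i j)
        have h1 : ∀ j ∈ relevant P, prob (Q j) ≤ (1 / 16) ^ t := by
          intro j hj
          have h2 : prob (Q j) = prob (fun u => decode (blockFun f P b j) x u ≠ x (i j)) ^ t :=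
            (prob_comp_snd (α := (Cube n × Cube n) × Cube n) fun U : Fin t → Cube n =>
              ∀ k, decode (blockFun f P b j) x (U k) ≠ x (i j)).trans
              (prob_forall_eq_pow (fun u => decode (blockFun f P b j) x u ≠ x (i j)) t)
          rw [h2]
          exact pow_le_pow_left₀ (prob_nonneg _) (hi j hj x) t
        have h3 : prob (fun ω : RoundSeed n t => RoundCheck f P b x ω) ≤
            prob fun ω : RoundSeed n t => ∃ j ∈ relevant P, Q j ω := by
          refine prob_mono fun ω hω => ?_
          by_contra! hc
          simp only [Q, not_forall, not_not] at hc
          obtain ⟨-, v, hv, hfv⟩ := hω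
          refine hfx (hfv.trans (eq_of_forall_isRelevant fun j hj => ?_))
          obtain ⟨k, hk⟩ := hc j (mem_relevant.2 hj)
          rw [← hv j (mem_relevant.2 hj) k, hk]; rfl
        have h4 : ∑ j ∈ relevant P, prob (Q j) ≤ (s * d : ℕ) * (1 / 16) ^ t := by
          refine (Finset.sum_le_card_nsmul _ _ _ h1).trans ?_
          rw [nsmul_eq_mul]
          have := card_relevant_le hP
          gcongr
        have h5 : ((s * d : ℕ) : ℝ) * (1 / 16) ^ t ≤ 1 / 2 := by
          have h6 : (2 : ℝ) * (s * d : ℕ) ≤ 16 ^ t := by exact_mod_cast ht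
          rw [one_div_pow, mul_one_div, div_le_iff₀ (by positivity)]
          linarith
        have h7 := h3.trans ((prob_exists_mem_le _ _).trans (h4.trans h5))
        simp only [ne_eq, hfx, not_false_eq_true, if_true]
        linarith
    calc _ ≤ ∑ x, (D x).toReal * (1 - (if f x ≠ h x then 1 else 0) / 2) :=
          Finset.sum_le_sum fun x _ => mul_le_mul_of_nonneg_left (hx x) ENNReal.toReal_nonneg
      _ = 1 - disagree D f h / 2 := by
          simp only [mul_sub, mul_one, Finset.sum_sub_distrib, sum_toReal_eq_one, disagree_eq_sum,
            Finset.sum_div, mul_div_assoc]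
      _ ≤ 1 - ε / 32 := by linarith

/-- If `b` separates the variables of `f` and `P` is the function that `f` induces on the blocks,
then verification rounds accept. -/
theorem roundCheck_of_injOn {f : BoolFun n} {R : Finset (Fin n)}
    (hR : ∀ x y : Cube n, (∀ i ∈ R, x i = y i) → f x = f y) {b : Fin n → Fin r}
    (hb : Set.InjOn b R) {P : BoolFun r} (hP : ∀ y, P y = f (y ∘ b)) (x : Cube n)
    (ω : RoundSeed n t) : RoundCheck f P b x ω := by
  classical
  have hdep : ∀ y y' : Cube r, (∀ j ∈ R.image b, y j = y' j) → P y = P y' := by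
    intro y y' h
    rw [hP, hP]
    exact hR _ _ fun i hi => h _ (Finset.mem_image_of_mem b hi)
  -- The block holds only one variable of `R`, so the restriction depends on `z i` alone;
  -- sensitivity makes its two values differ, and the normalization sends `0` to `0`.
  have hblock : ∀ i ∈ R, IsRelevant P (b i) → ∀ z, blockFun f P b (b i) z = z i := by
    intro i hi hrel z
    have h1 : f (blockPoint b (witness P (b i)) (b i) z) =
        P (Function.update (witness P (b i)) (b i) (z i)) := by
      rw [hP]
      refine hR _ _ fun k hk => ?_
      by_cases hki : b k = b i
      · rw [hb hk hi hki]; simp [blockPoint]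
      · simp [blockPoint, hki]
    have h2 := witness_spec hrel
    rw [blockFun, h1]
    rcases zmod_two_eq_zero_or_one (z i) with h | h
    · rw [h, CharTwo.add_self_eq_zero]
    · rw [h]
      revert h2
      generalize P _ = a; generalize P _ = c
      revert a c; decide
  have hrel : ∀ j ∈ relevant P, ∃ i ∈ R, b i = j := fun j hj => by
    simpa using mem_of_isRelevant hdep (mem_relevant.1 hj)
  have hdec : ∀ i ∈ R, b i ∈ relevant P → ∀ p u, decode (blockFun f P b (b i)) p u = p i := by
    intro i hi hj p u
    rw [decode, hblock i hi (mem_relevant.1 hj), hblock i hi (mem_relevant.1 hj), Pi.add_apply,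
      add_assoc, CharTwo.add_self_eq_zero, add_zero]
  -- Blocks that miss `R` get the value `0`, which `f` never sees.
  refine ⟨fun j hj => ?_, fun j => if h : ∃ i ∈ R, b i = j then x h.choose else 0,
    fun j hj k => ?_, ?_⟩
  · obtain ⟨i, hi, rfl⟩ := hrel j hj
    refine ⟨?_, ?_, ?_⟩
    · simp [hblock i hi (mem_relevant.1 hj)]
    · simp [hdec i hi hj]
    · simp [hdec i hi hj]
  · have h := hrel j hj
    beta_reduce
    rw [dif_pos h]
    have h2 := h.choose_spec
    have h3 := hdec h.choose h2.1 (h2.2.symm ▸ hj) x (ω.2 k)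
    rwa [h2.2] at h3
  · rw [hP]
    refine hR _ _ fun i hi => ?_
    have h : ∃ k ∈ R, b k = b i := ⟨i, hi, rfl⟩
    simp only [Function.comp_apply, dif_pos h]
    rw [hb h.choose_spec.1 hi h.choose_spec.2]

theorem accept_roundAlg_eq_one {f : BoolFun n} {R : Finset (Fin n)}
    (hR : ∀ x y : Cube n, (∀ i ∈ R, x i = y i) → f x = f y) {b : Fin n → Fin r}
    (hb : Set.InjOn b R) {P : BoolFun r} (hP : ∀ y, P y = f (y ∘ b)) (D : PMF (Cube n)) :
    (roundAlg P b t).accept f D = 1 := by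
  rw [accept_roundAlg, ← sum_toReal_eq_one D]
  refine Finset.sum_congr rfl fun x _ => ?_
  rw [prob_of_forall fun ω => roundCheck_of_injOn hR hb hP x ω, mul_one]

end round

/-! ### Random partitions and random evaluation points -/

section random

variable {n r s d : ℕ}

/-- With all other values of `b` fixed, `b i` is still uniform. -/
theorem prob_apply_eq_apply_le {i k : Fin n} (hik : i ≠ k) (r : ℕ) :
    prob (fun b : Fin n → Fin (r + 1) => b i = b k) ≤ 1 / (r + 1) := by
  classical
  let e := (Equiv.prodComm _ _).trans (Equiv.funSplitAt i (Fin (r + 1))).symm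
  rw [← prob_equiv e]
  refine prob_prod_le fun b' => ?_
  have h : ∀ c, e (b', c) i = c ∧ e (b', c) k = b' ⟨k, hik.symm⟩ := by
    intro c
    simp [e, Equiv.funSplitAt, Equiv.piSplitAt, hik.symm]
  simp only [h]
  rw [prob_eq_card_div]
  simp [Finset.filter_eq']

theorem prob_not_injOn_le (R : Finset (Fin n)) (r : ℕ) :
    prob (fun b : Fin n → Fin (r + 1) => ¬ Set.InjOn b R) ≤ (R.card : ℝ) ^ 2 / (r + 1) := by
  classical
  have h1 : prob (fun b : Fin n → Fin (r + 1) => ¬ Set.InjOn b R) ≤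
      prob fun b : Fin n → Fin (r + 1) => ∃ q ∈ R.offDiag, b q.1 = b q.2 := by
    refine prob_mono fun b hb => ?_
    simp only [Set.InjOn, not_forall] at hb
    obtain ⟨i, hi, k, hk, hbik, hne⟩ := hb
    exact ⟨(i, k), Finset.mem_offDiag.2 ⟨hi, hk, hne⟩, hbik⟩
  have h2 : ∀ q ∈ R.offDiag, prob (fun b : Fin n → Fin (r + 1) => b q.1 = b q.2) ≤ 1 / (r + 1) :=
    fun q hq => prob_apply_eq_apply_le (Finset.mem_offDiag.1 hq).2.2 r
  refine h1.trans ((prob_exists_mem_le _ _).trans ((Finset.sum_le_card_nsmul _ _ _ h2).trans ?_))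
  rw [nsmul_eq_mul, mul_one_div]
  gcongr
  rw [Finset.offDiag_card, sq]
  exact_mod_cast Nat.sub_le _ _

/-- A set of at most `s` elements is encoded by `s` choices, each an element to insert or none. -/
theorem card_filter_powerset_le {α : Type*} [DecidableEq α] (A : Finset α) (s : ℕ) :
    (A.powerset.filter fun G => G.card ≤ s).card ≤ (A.card + 1) ^ s := by
  induction s with
  | zero =>
    refine (Finset.card_le_card (t := {∅}) fun G hG => ?_).trans (by simp)
    simpa using (Finset.mem_filter.1 hG).2
  | succ s ih =>
    have hsub : (A.powerset.filter fun G => G.card ≤ s + 1) ⊆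
        ((A.powerset.filter fun G => G.card ≤ s) ×ˢ A.insertNone).image
          fun q => q.2.elim q.1 fun a => insert a q.1 := by
      intro G hG
      obtain ⟨h1, h2⟩ := Finset.mem_filter.1 hG
      rw [Finset.mem_powerset] at h1
      rw [Finset.mem_image]
      rcases G.eq_empty_or_nonempty with rfl | ⟨a, ha⟩
      · exact ⟨(∅, none), by simp, rfl⟩
      · refine ⟨(G.erase a, some a), ?_, by simp [Finset.insert_erase ha]⟩
        simp only [Finset.mem_product, Finset.mem_filter, Finset.mem_powerset,
          Finset.some_mem_insertNone]
        exact ⟨⟨(Finset.erase_subset _ _).trans h1, by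
          rw [Finset.card_erase_of_mem ha]; omega⟩, h1 ha⟩
    refine (Finset.card_le_card hsub).trans (Finset.card_image_le.trans ?_)
    rw [Finset.card_product, Finset.card_insertNone, pow_succ]
    exact Nat.mul_le_mul_right _ ih

open Classical in
/-- The sparse polynomials as a finite set. -/
noncomputable def sparsePolys (r s d : ℕ) : Finset (BoolFun r) :=
  Finset.univ.filter fun f => f ∈ sparsePoly r s d

/-- The counting bound is used twice: for terms as small sets of variables, then for polynomials as
small sets of terms. -/
theorem card_sparsePolys_le (r s d : ℕ) :
    (sparsePolys r s d).card ≤ ((r + 1) ^ d + 1) ^ s := by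
  classical
  let 𝒯 : Finset (Finset (Fin r)) := Finset.univ.powerset.filter fun T => T.card ≤ d
  have h𝒯 : 𝒯.card ≤ (r + 1) ^ d := by
    simpa [𝒯] using card_filter_powerset_le (Finset.univ : Finset (Fin r)) d
  have hsub : sparsePolys r s d ⊆ (𝒯.powerset.filter fun G => G.card ≤ s).image
      fun G x => ∑ S ∈ G, ∏ i ∈ S, x i := by
    intro f hf
    obtain ⟨F, h1, h2, h3⟩ := (Finset.mem_filter.1 hf).2
    refine Finset.mem_image.2 ⟨F, Finset.mem_filter.2 ⟨Finset.mem_powerset.2 fun S hS => ?_, h1⟩,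
      (funext h3).symm⟩
    exact Finset.mem_filter.2 ⟨by simp, h2 S hS⟩
  refine (Finset.card_le_card hsub).trans (Finset.card_image_le.trans
    ((card_filter_powerset_le _ _).trans ?_))
  gcongr

/-- A batch of `2 ^ d` random points misses a wrong candidate with probability at most one half. -/
theorem one_sub_half_pow_pow_le (d : ℕ) : (1 - (1 / 2 : ℝ) ^ d) ^ 2 ^ d ≤ 1 / 2 := by
  have h0 : (1 / 2 : ℝ) ^ d ≤ 1 := pow_le_one₀ (by norm_num) (by norm_num)
  have h1 : 1 - (1 / 2 : ℝ) ^ d ≤ Real.exp (-(1 / 2 : ℝ) ^ d) := by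
    have := Real.add_one_le_exp (-(1 / 2 : ℝ) ^ d); linarith
  have h2 : ((2 ^ d : ℕ) : ℝ) * -(1 / 2 : ℝ) ^ d = -1 := by
    push_cast
    rw [mul_neg, ← mul_pow]; norm_num
  calc (1 - (1 / 2 : ℝ) ^ d) ^ 2 ^ d ≤ Real.exp (-(1 / 2 : ℝ) ^ d) ^ 2 ^ d :=
        pow_le_pow_left₀ (by linarith) h1 _
    _ = Real.exp (-1) := by rw [← Real.exp_nat_mul, h2]
    _ ≤ 1 / 2 := by have := Real.exp_neg_one_lt_d9; linarith

/-- Few random points determine a sparse polynomial. -/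
theorem prob_not_determined_le {F : BoolFun r} (hF : F ∈ sparsePoly r s d) {L : ℕ}
    (hL : ((r + 1) ^ d + 1) ^ s ≤ 2 ^ L) :
    prob (fun pts : Fin (2 ^ d * (L + 3)) → Cube r =>
      ¬ ∀ P ∈ sparsePoly r s d, (∀ k, P (pts k) = F (pts k)) → P = F) ≤ 1 / 8 := by
  classical
  let Q := (sparsePolys r s d).erase F
  have h1 : prob (fun pts : Fin (2 ^ d * (L + 3)) → Cube r =>
      ¬ ∀ P ∈ sparsePoly r s d, (∀ k, P (pts k) = F (pts k)) → P = F) ≤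
      prob fun pts : Fin (2 ^ d * (L + 3)) → Cube r => ∃ P ∈ Q, ∀ k, P (pts k) = F (pts k) := by
    refine prob_mono fun pts h => ?_
    push Not at h
    obtain ⟨P, hP, hk, hne⟩ := h
    exact ⟨P, Finset.mem_erase.2 ⟨hne, Finset.mem_filter.2 ⟨Finset.mem_univ _, hP⟩⟩, hk⟩
  -- There are `L + 3` batches, each halving the chance of survival; `L` of them pay for the union
  -- bound and three leave `1/8`.
  have h2 : ∀ P ∈ Q, prob (fun pts : Fin (2 ^ d * (L + 3)) → Cube r => ∀ k, P (pts k) = F (pts k))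
      ≤ (1 / 2) ^ (L + 3) := by
    intro P hP
    obtain ⟨hne, hP⟩ := Finset.mem_erase.1 hP
    have hP := (Finset.mem_filter.1 hP).2
    have h3 := ((HasDegreeLE.of_mem_sparsePoly hP).add
      (HasDegreeLE.of_mem_sparsePoly hF)).prob_ne_zero_ge fun h0 =>
        hne (funext fun x => CharTwo.add_eq_zero.1 (congrFun h0 x))
    have h4 : prob (fun x => P x + F x ≠ 0) = 1 - prob fun x => P x = F x := by
      rw [← prob_not]; simp [CharTwo.add_eq_zero]
    rw [h4] at h3
    rw [prob_forall_eq_pow fun x => P x = F x, pow_mul]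
    refine pow_le_pow_left₀ (pow_nonneg (prob_nonneg _) _) ?_ _
    exact (pow_le_pow_left₀ (prob_nonneg _) (by linarith) _).trans (one_sub_half_pow_pow_le d)
  have hcard : (Q.card : ℝ) ≤ 2 ^ L := by
    exact_mod_cast (Finset.card_le_card (Finset.erase_subset _ _)).trans
      ((card_sparsePolys_le r s d).trans hL)
  refine h1.trans ((prob_exists_mem_le _ _).trans ((Finset.sum_le_card_nsmul _ _ _ h2).trans ?_))
  rw [nsmul_eq_mul]
  calc (Q.card : ℝ) * (1 / 2) ^ (L + 3) ≤ 2 ^ L * (1 / 2) ^ (L + 3) := by gcongr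
    _ = 1 / 8 := by rw [pow_add, ← mul_assoc, ← mul_pow]; norm_num

end random

/-! ### The tester -/

section tester

variable {n s d : ℕ}

open Classical in
/-- The tester: partition the variables into `r + 1` random blocks, guess a sparse polynomial `P`
in the blocks from `m` random evaluations, and run `M` verification rounds on `P`. -/
noncomputable def tester (n s d r m t M : ℕ) : QueryAlg n :=
  .randOver (Fin n → Fin (r + 1)) fun b => .randOver (Fin m → Cube (r + 1)) fun pts =>
    .queryAll (Finset.univ.image fun k => pts k ∘ b) fun a =>
      if h : ∃ P ∈ sparsePoly (r + 1) s d, ∀ k, P (pts k) = a (pts k ∘ b) then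
        .repeatAll (roundAlg h.choose b t) M
      else .output false

theorem queries_tester_le (f : BoolFun n) (r m t M : ℕ) :
    (tester n s d r m t M).queries f ≤ M * (s * d * (8 + 2 * t) + 2) + m := by
  classical
  refine QueryAlg.queries_randOver_le _ _ fun b => QueryAlg.queries_randOver_le _ _ fun pts => ?_
  obtain ⟨g, -, -, h2⟩ := QueryAlg.queryAll_spec (Finset.univ.image fun k => pts k ∘ b) (fun a =>
      if h : ∃ P ∈ sparsePoly (r + 1) s d, ∀ k, P (pts k) = a (pts k ∘ b) then
        .repeatAll (roundAlg h.choose b t) M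
      else .output false) f
  rw [h2]
  refine add_le_add ?_ (Finset.card_image_le.trans (by simp))
  split_ifs with h
  · exact (QueryAlg.queries_repeatAll_le _ _ _).trans
      (Nat.mul_le_mul_left _ (queries_roundAlg_le f h.choose_spec.1 b))
  · simp [QueryAlg.queries]

/-- The bound holds for each fixed partition and sample: rounds are sound for every `P` in the
class, and `64/ε` of them bring acceptance down to `e⁻²`. -/
theorem accept_tester_le {f : BoolFun n} {D : PMF (Cube n)} {ε : ℝ} (hs : 1 ≤ s) (hε : 0 < ε)
    (hf : IsFarFrom D ε f (sparsePoly n s d)) (r m : ℕ) {t M : ℕ} (ht : 2 * (s * d) ≤ 16 ^ t)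
    (hM : 64 / ε ≤ M) : (tester n s d r m t M).accept f D ≤ 1 / 3 := by
  classical
  have hexp : ∀ {Ω : Type} [Fintype Ω] [Nonempty Ω] (F : Ω → ℝ), (∀ ω, F ω ≤ 1 / 3) →
      (𝔼 ω, F ω) ≤ 1 / 3 := fun {Ω} _ _ F hF =>
    (Finset.expect_le_expect fun ω _ => hF ω).trans_eq (Fintype.expect_const (ι := Ω) (1 / 3 : ℝ))
  rw [tester, QueryAlg.accept_randOver]
  refine hexp _ fun b => ?_
  rw [QueryAlg.accept_randOver]
  refine hexp _ fun pts => ?_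
  obtain ⟨g, -, h1, -⟩ := QueryAlg.queryAll_spec (Finset.univ.image fun k => pts k ∘ b) (fun a =>
      if h : ∃ P ∈ sparsePoly (r + 1) s d, ∀ k, P (pts k) = a (pts k ∘ b) then
        .repeatAll (roundAlg h.choose b t) M
      else .output false) f
  rw [h1]
  split_ifs with h
  · rw [QueryAlg.accept_repeatAll]
    have h2 := accept_roundAlg_le hs hε hf h.choose_spec.1 b ht
    have h3 : (roundAlg h.choose b t).accept f D ≤ Real.exp (-(ε / 32)) :=
      h2.trans (by have := Real.add_one_le_exp (-(ε / 32)); linarith)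
    have h4 : (M : ℝ) * -(ε / 32) ≤ -1 + -1 := by
      rw [div_le_iff₀ hε] at hM; linarith
    calc _ ≤ Real.exp (-(ε / 32)) ^ M := pow_le_pow_left₀ (QueryAlg.accept_nonneg _ _ _) h3 M
      _ = Real.exp (M * -(ε / 32)) := (Real.exp_nat_mul _ _).symm
      _ ≤ Real.exp (-1 + -1) := Real.exp_le_exp.2 h4
      _ = Real.exp (-1) * Real.exp (-1) := Real.exp_add _ _
      _ ≤ (1 / 2) * (1 / 2) := by
          have := Real.exp_neg_one_lt_d9
          have := Real.exp_pos (-1)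
          gcongr <;> linarith
      _ ≤ 1 / 3 := by norm_num
  · rw [QueryAlg.accept_output]; norm_num

/-- The only failures are a collision of variables (`1/6`) and an undetermined polynomial (`1/8`),
together `7/24 < 1/3`. Otherwise `P` is the collapsed `f` and every round accepts with certainty. -/
theorem accept_tester_ge {f : BoolFun n} (hf : f ∈ sparsePoly n s d) (D : PMF (Cube n)) {L : ℕ}
    (hL : ((6 * (s * d) ^ 2 + 1 + 1) ^ d + 1) ^ s ≤ 2 ^ L) (t M : ℕ) :
    2 / 3 ≤ (tester n s d (6 * (s * d) ^ 2) (2 ^ d * (L + 3)) t M).accept f D := by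
  classical
  set r := 6 * (s * d) ^ 2 with hr
  set m := 2 ^ d * (L + 3) with hm
  obtain ⟨R, hRc, hR⟩ := exists_support hf
  let Det : (Fin n → Fin (r + 1)) × (Fin m → Cube (r + 1)) → Prop := fun q =>
    ∀ P ∈ sparsePoly (r + 1) s d, (∀ k, P (q.2 k) = f (q.2 k ∘ q.1)) → P = fun y => f (y ∘ q.1)
  let Good : (Fin n → Fin (r + 1)) × (Fin m → Cube (r + 1)) → Prop := fun q =>
    Set.InjOn q.1 R ∧ Det q
  have hbad : prob (fun q => ¬ Good q) ≤ 1 / 6 + 1 / 8 := by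
    have h1 : prob (fun q : (Fin n → Fin (r + 1)) × (Fin m → Cube (r + 1)) =>
        ¬ Set.InjOn q.1 R) ≤ 1 / 6 := by
      rw [prob_comp_fst fun b : Fin n → Fin (r + 1) => ¬ Set.InjOn b R]
      refine (prob_not_injOn_le R r).trans ?_
      have h2 : (R.card : ℝ) ≤ (s * d : ℕ) := by exact_mod_cast hRc
      have h3 : (r : ℝ) = 6 * ((s * d : ℕ) : ℝ) ^ 2 := by rw [hr]; push_cast; ring
      rw [div_le_iff₀ (by positivity), h3]
      have : (R.card : ℝ) ^ 2 ≤ ((s * d : ℕ) : ℝ) ^ 2 := by gcongr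
      linarith
    have h2 : prob (fun q => ¬ Det q) ≤ 1 / 8 :=
      prob_prod_le fun b => prob_not_determined_le (comp_mem_sparsePoly hf b) hL
    refine (prob_mono fun q hq => ?_).trans (prob_or_le_add h1 h2)
    exact not_and_or.1 hq
  rw [prob_not] at hbad
  refine le_trans (show (2 / 3 : ℝ) ≤ prob Good by linarith) ?_
  rw [prob_prod, tester, QueryAlg.accept_randOver]
  refine Finset.expect_le_expect fun b _ => ?_
  rw [prob, QueryAlg.accept_randOver]
  refine Finset.expect_le_expect fun pts _ => ?_
  split_ifs with hgood
  swap
  · exact QueryAlg.accept_nonneg _ _ _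
  obtain ⟨g, hg, h1, -⟩ := QueryAlg.queryAll_spec (Finset.univ.image fun k => pts k ∘ b) (fun a =>
      if h : ∃ P ∈ sparsePoly (r + 1) s d, ∀ k, P (pts k) = a (pts k ∘ b) then
        .repeatAll (roundAlg h.choose b t) M
      else .output false) f
  have hg' : ∀ k, g (pts k ∘ b) = f (pts k ∘ b) := fun k => hg _ (by simp)
  rw [h1]
  have hex : ∃ P ∈ sparsePoly (r + 1) s d, ∀ k, P (pts k) = g (pts k ∘ b) :=
    ⟨_, comp_mem_sparsePoly hf b, fun k => (hg' k).symm⟩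
  rw [dif_pos hex, QueryAlg.accept_repeatAll]
  have hP := hgood.2 hex.choose hex.choose_spec.1
    fun k => (hex.choose_spec.2 k).trans (hg' k)
  rw [accept_roundAlg_eq_one hR hgood.1 (congrFun hP), one_pow]

end tester

/-! ### The query complexity -/

/-- The factor `2` absorbs `1 / log 2`. -/
theorem natLog_le {k : ℕ} {x : ℝ} (hx : 1 ≤ x) (hk : (k : ℝ) ≤ x) :
    (Nat.log 2 k : ℝ) ≤ 2 * Real.log x := by
  rcases Nat.eq_zero_or_pos k with rfl | hk0
  · simpa using Real.log_nonneg hx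
  have h1 : ((2 ^ Nat.log 2 k : ℕ) : ℝ) ≤ x :=
    (Nat.cast_le.2 (Nat.pow_log_le_self 2 hk0.ne')).trans hk
  have h2 := Real.log_le_log (by positivity) h1
  push_cast at h2
  rw [Real.log_pow] at h2
  have h3 := Real.log_two_gt_d9
  have h4 : (0 : ℝ) ≤ Nat.log 2 k := Nat.cast_nonneg _
  nlinarith

theorem exists_tester (n s d : ℕ) (ε : ℝ) (hs : 1 ≤ s) (hε : 0 < ε) :
    ∃ A : QueryAlg n, A.IsDistFreeTester (sparsePoly n s d) ε ∧ ∀ f : BoolFun n,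
      (A.queries f : ℝ) ≤ 2000 * ((s : ℝ) / ε + (s : ℝ) * 2 ^ d) *
        (1 + Real.log ((s : ℝ) / ε + (s : ℝ) * 2 ^ d)) ^ 2 := by
  -- `2 ^ a` exceeds the number of blocks plus one, so a term costs at most `a * d + 1` bits and a
  -- polynomial `L` bits.
  let a := Nat.log 2 (6 * (s * d) ^ 2 + 2) + 1
  let t := Nat.log 2 (2 * (s * d)) + 1
  let M := ⌈64 / ε⌉₊
  let L := (a * d + 1) * s
  have hL : ((6 * (s * d) ^ 2 + 1 + 1) ^ d + 1) ^ s ≤ 2 ^ L := by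
    rw [pow_mul]
    refine Nat.pow_le_pow_left ?_ s
    have h1 : (6 * (s * d) ^ 2 + 1 + 1) ^ d ≤ 2 ^ (a * d) := by
      rw [pow_mul]
      exact Nat.pow_le_pow_left (Nat.lt_pow_succ_log_self (by norm_num) _).le d
    have h2 : 1 ≤ 2 ^ (a * d) := Nat.one_le_two_pow
    rw [pow_succ 2 (a * d)]; omega
  have ht : 2 * (s * d) ≤ 16 ^ t :=
    (Nat.lt_pow_succ_log_self (b := 2) (by norm_num) (2 * (s * d))).le.trans
      (Nat.pow_le_pow_left (by norm_num) t)
  refine ⟨tester n s d (6 * (s * d) ^ 2) (2 ^ d * (L + 3)) t M, fun D => ⟨fun f hf => ?_,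
    fun f hf => ?_⟩, fun f => ?_⟩
  · exact accept_tester_ge hf D hL t M
  · rw [QueryAlg.run_false_toReal]
    have := accept_tester_le hs hε hf (6 * (s * d) ^ 2) (2 ^ d * (L + 3)) ht (Nat.le_ceil (64 / ε))
    linarith
  · have hq : ((tester n s d (6 * (s * d) ^ 2) (2 ^ d * (L + 3)) t M).queries f : ℝ) ≤
        M * (s * d * (8 + 2 * t) + 2) + 2 ^ d * (L + 3) := by
      exact_mod_cast queries_tester_le f (6 * (s * d) ^ 2) (2 ^ d * (L + 3)) t M
    set T : ℝ := (s : ℝ) / ε + (s : ℝ) * 2 ^ d with hT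
    have hs1 : (1 : ℝ) ≤ s := by exact_mod_cast hs
    have h2d : (1 : ℝ) ≤ 2 ^ d := one_le_pow₀ (by norm_num)
    have hd0 : (0 : ℝ) ≤ d := Nat.cast_nonneg _
    have hsε : 0 < (s : ℝ) / ε := by positivity
    have hsε2 : (s : ℝ) / ε ≤ T := le_add_of_nonneg_right (by positivity)
    have hs2 : (s : ℝ) * 2 ^ d ≤ T := by linarith
    have hsT : (s : ℝ) ≤ T := (le_mul_of_one_le_right (by positivity) h2d).trans hs2
    have hT1 : 1 ≤ T := hs1.trans hsT
    have h2T : (2 : ℝ) ^ d ≤ T := (le_mul_of_one_le_left (by positivity) hs1).trans hs2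
    have hsd : (s : ℝ) * d ≤ T := by
      have : (d : ℝ) ≤ 2 ^ d := by exact_mod_cast Nat.lt_two_pow_self.le
      exact (mul_le_mul_of_nonneg_left this (by positivity)).trans hs2
    have hlog0 : 0 ≤ Real.log T := Real.log_nonneg hT1
    have hlog2 : Real.log 2 ≤ 0.7 := by have := Real.log_two_lt_d9; linarith
    set l : ℝ := 1 + Real.log T with hl
    have hl1 : 1 ≤ l := by linarith
    -- Since `2 ^ d ≤ T`, the degree is only logarithmic in `T`; this lets `sd/ε` count as `Õ(s/ε)`.
    have hd : (d : ℝ) ≤ 2 * l := by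
      have h1 := Real.log_le_log (by positivity) h2T
      rw [Real.log_pow] at h1
      have h3 := Real.log_two_gt_d9
      nlinarith
    have htl : (t : ℝ) ≤ 3 * l := by
      have h1 : (Nat.log 2 (2 * (s * d)) : ℝ) ≤ 2 * Real.log (2 * T) :=
        natLog_le (by linarith) (by push_cast; linarith)
      rw [Real.log_mul (by norm_num) (by positivity)] at h1
      have h2 : (t : ℝ) = Nat.log 2 (2 * (s * d)) + 1 := by simp [t]
      rw [h2]; linarith
    have hal : (a : ℝ) ≤ 6 * l := by
      have h0 : (6 : ℝ) * (s * d) ^ 2 + 2 ≤ 2 ^ 3 * T ^ 2 := by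
        have : ((s : ℝ) * d) ^ 2 ≤ T ^ 2 := by gcongr
        have : 1 ≤ T ^ 2 := one_le_pow₀ hT1
        linarith
      have h1 : (Nat.log 2 (6 * (s * d) ^ 2 + 2) : ℝ) ≤ 2 * Real.log (2 ^ 3 * T ^ 2) :=
        natLog_le (le_trans (by have := sq_nonneg ((s : ℝ) * d); linarith) h0)
          (by push_cast; exact h0)
      rw [Real.log_mul (by norm_num) (by positivity), Real.log_pow, Real.log_pow] at h1
      have h2 : (a : ℝ) = Nat.log 2 (6 * (s * d) ^ 2 + 2) + 1 := by simp [a]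
      push_cast at h1
      rw [h2]; linarith
    have hl2 : l ≤ l ^ 2 := by nlinarith
    have hM : (M : ℝ) ≤ 64 / ε + 1 := (Nat.ceil_lt_add_one (by positivity)).le
    have hround : (s : ℝ) * d * (8 + 2 * t) + 2 ≤ s * (30 * l ^ 2) := by
      have h1 : (d : ℝ) * (8 + 2 * t) ≤ 2 * l * (14 * l) := by
        gcongr; linarith
      calc (s : ℝ) * d * (8 + 2 * t) + 2 ≤ s * (d * (8 + 2 * t)) + s * 2 := by nlinarith
        _ = s * (d * (8 + 2 * t) + 2) := by ring
        _ ≤ s * (30 * l ^ 2) := by gcongr; nlinarith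
    have hlearn : (2 : ℝ) ^ d * (L + 3) ≤ T * (16 * l ^ 2) := by
      have h1 : (a : ℝ) * d ≤ 6 * l * (2 * l) := by gcongr
      have h2 : (L : ℝ) = (a * d + 1) * s := by simp [L]
      calc (2 : ℝ) ^ d * (L + 3) ≤ 2 ^ d * ((a * d + 1) * s + 3 * s) := by
            rw [h2]; gcongr; linarith
        _ = s * 2 ^ d * (a * d + 4) := by ring
        _ ≤ T * (16 * l ^ 2) := by gcongr; nlinarith
    have hverify : (M : ℝ) * (s * d * (8 + 2 * t) + 2) ≤ T * (1950 * l ^ 2) := by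
      calc (M : ℝ) * (s * d * (8 + 2 * t) + 2) ≤ (64 / ε + 1) * (s * (30 * l ^ 2)) := by gcongr
        _ = (64 * (s / ε) + s) * (30 * l ^ 2) := by ring
        _ ≤ (65 * T) * (30 * l ^ 2) := by gcongr; linarith
        _ = T * (1950 * l ^ 2) := by ring
    have : 0 ≤ T * l ^ 2 := by positivity
    -- Verification and learning contribute `1950 + 16 ≤ 2000`.
    nlinarith

end SparsePolyTest

/-- `s`-sparse polynomials of degree `d` over `F_2` can be `ε`-tested with
`Õ(s/ε + s 2^d)` queries in the uniform model and with `Õ(s²/ε + s 2^d)` queries in the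
distribution-free model, where `Õ(T)` stands for `O(T · poly(log T))`. -/
theorem mainTheorem8 :
    (∃ (K : ℝ) (c : ℕ), ∀ (n s d : ℕ) (ε : ℝ), 1 ≤ s → 0 < ε →
      ∃ A : SparsePolyTest.QueryAlg n,
        A.IsUniformTester (SparsePolyTest.sparsePoly n s d) ε ∧
        ∀ f : SparsePolyTest.BoolFun n,
          (A.queries f : ℝ) ≤
            K * ((s : ℝ) / ε + (s : ℝ) * 2 ^ d) *
              (1 + Real.log ((s : ℝ) / ε + (s : ℝ) * 2 ^ d)) ^ c) ∧
    (∃ (K : ℝ) (c : ℕ), ∀ (n s d : ℕ) (ε : ℝ), 1 ≤ s → 0 < ε →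
      ∃ A : SparsePolyTest.QueryAlg n,
        A.IsDistFreeTester (SparsePolyTest.sparsePoly n s d) ε ∧
        ∀ f : SparsePolyTest.BoolFun n,
          (A.queries f : ℝ) ≤
            K * ((s : ℝ) ^ 2 / ε + (s : ℝ) * 2 ^ d) *
              (1 + Real.log ((s : ℝ) ^ 2 / ε + (s : ℝ) * 2 ^ d)) ^ c) := by
  refine ⟨⟨2000, 2, fun n s d ε hs hε => ?_⟩, ⟨2000, 2, fun n s d ε hs hε => ?_⟩⟩
  · obtain ⟨A, hA, hq⟩ := SparsePolyTest.exists_tester n s d ε hs hε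
    exact ⟨A, hA _, hq⟩
  · obtain ⟨A, hA, hq⟩ := SparsePolyTest.exists_tester n s d ε hs hε
    refine ⟨A, hA, fun f => (hq f).trans ?_⟩
    have hs1 : (1 : ℝ) ≤ s := by exact_mod_cast hs
    have h2d : (1 : ℝ) ≤ 2 ^ d := one_le_pow₀ (by norm_num)
    have hT1 : (1 : ℝ) ≤ (s : ℝ) / ε + (s : ℝ) * 2 ^ d := by
      have : 0 < (s : ℝ) / ε := by positivity
      nlinarith
    -- As `s ≥ 1`, the first bound lies below the second, and `T (1 + log T)²` is monotone for `T ≥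
    -- 1`.
    have hle : (s : ℝ) / ε + (s : ℝ) * 2 ^ d ≤ (s : ℝ) ^ 2 / ε + (s : ℝ) * 2 ^ d := by
      gcongr
      exact le_self_pow₀ hs1 (by norm_num)
    have hlog := Real.log_nonneg hT1
    gcongr
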